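/- Let $\Omega\subset\mathbb R^3$ be a bounded open set (for instance a bounded domain with smooth boundary), and let $-\Delta_D$ be the Dirichlet Laplacian on $L^2(\Omega)=L^2(\Omega;\mathbb C)$, i.e. the nonnegative self-adjoint operator of the form $\int_\Omega\nabla u\cdot\overline{\nabla w}\,dx$ on $H^1_0(\Omega)$. For $s\ge 0$ let $H^s_D(\Omega)$ be the domain of $(-\Delta_D)^{s/2}$ with its graph norm, and for $\lambda\ge0$ let $\Pi_\lambda=1_{\sqrt{-\Delta_D}\in[\lambda,\lambda+1)}$ be the spectral projector. Assume that for some $2\le q<\infty$, $\delta\in\mathbb R$ and $C_0$, $$\|\Pi_\lambda u\|_{L^q(\Omega)}\le C_0\,(1+\lambda)^{\delta}\,\|u\|_{L^2(\Omega)}\qquad\text{for all }\lambda\ge 0\text{ and all }u\in L^2(\Omega).$$ Then there is a constant $C$ (depending only on $\Omega$, $q$, $\delta$ and $C_0$) such that for every $u_0\in H_D^{\delta+\frac12-\frac1q}(\Omega)$ the function $v(t,x)=(e^{it\sqrt{-\Delta_D}}u_0)(x)$ belongs to $L^q((0,2\pi)\times\Omega)$ and $$\|v\|_{L^q((0,2\pi)\times\Omega)}\le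 C\,\|u_0\|_{H_D^{\delta+\frac12-\frac1q}(\Omega)}.$$ -/

import Mathlib

open MeasureTheory TopologicalSpace
open scoped NNReal ENNReal Distributions

noncomputable section

namespace DirichletWave

/-- Euclidean space `ℝ³`. -/
abbrev E3 : Type := EuclideanSpace ℝ (Fin 3)

/-- Lebesgue measure on the open set `Ω`. -/
abbrev vol (Ω : Opens E3) : Measure E3 := volume.restrict (Ω : Set E3)

/-- The complex Hilbert space `L²(Ω)`. -/
abbrev L2 (Ω : Opens E3) : Type := Lp ℂ 2 (vol Ω)

/-- The partial derivative of `φ` in the `i`-th coordinate direction. -/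
def partialDeriv (φ : E3 → ℂ) (i : Fin 3) (x : E3) : ℂ :=
  fderiv ℝ φ x (EuclideanSpace.single i 1)

/-- The pairs `(φ, ∇φ)` with `φ ∈ C_c^∞(Ω)`, as elements of `L²(Ω) × L²(Ω)³`. -/
def testPairs (Ω : Opens E3) : Submodule ℂ (L2 Ω × (Fin 3 → L2 Ω)) where
  carrier := {p | ∃ φ : 𝓓(Ω, ℂ), (p.1 : E3 → ℂ) =ᵐ[vol Ω] φ ∧
    ∀ i, (p.2 i : E3 → ℂ) =ᵐ[vol Ω] partialDeriv φ i}
  zero_mem' := by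
    refine ⟨0, ?_, fun i => ?_⟩
    · filter_upwards [Lp.coeFn_zero ℂ 2 (vol Ω)] with x hx
      simpa using hx
    · filter_upwards [Lp.coeFn_zero ℂ 2 (vol Ω)] with x hx
      have h0 : ((0 : 𝓓(Ω, ℂ)) : E3 → ℂ) = fun _ => 0 := rfl
      simpa [partialDeriv, h0] using hx
  add_mem' := by
    rintro p r ⟨φ, hφ, hφ'⟩ ⟨ψ, hψ, hψ'⟩
    refine ⟨φ + ψ, ?_, fun i => ?_⟩
    · filter_upwards [Lp.coeFn_add p.1 r.1, hφ, hψ] with x hx h1 h2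
      simp only [Prod.fst_add, hx, Pi.add_apply, h1, h2]
      rfl
    · filter_upwards [Lp.coeFn_add (p.2 i) (r.2 i), hφ' i, hψ' i] with x hx h1 h2
      have h0 : ((φ + ψ : 𝓓(Ω, ℂ)) : E3 → ℂ) = (φ : E3 → ℂ) + (ψ : E3 → ℂ) := rfl
      have dφ : DifferentiableAt ℝ (φ : E3 → ℂ) x := φ.contDiff.differentiable (by simp) x
      have dψ : DifferentiableAt ℝ (ψ : E3 → ℂ) x := ψ.contDiff.differentiable (by simp) x
      simp only [Prod.snd_add, Pi.add_apply, hx, h1, h2, partialDeriv, h0, fderiv_add dφ dψ,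
        _root_.add_apply]
  smul_mem' := by
    rintro c p ⟨φ, hφ, hφ'⟩
    refine ⟨c • φ, ?_, fun i => ?_⟩
    · filter_upwards [Lp.coeFn_smul c p.1, hφ] with x hx h1
      simp only [Prod.smul_fst, hx, Pi.smul_apply, h1]
      rfl
    · filter_upwards [Lp.coeFn_smul c (p.2 i), hφ' i] with x hx h1
      have h0 : ((c • φ : 𝓓(Ω, ℂ)) : E3 → ℂ) = c • (φ : E3 → ℂ) := rfl
      have dφ : DifferentiableAt ℝ (φ : E3 → ℂ) x := φ.contDiff.differentiable (by simp) x
      simp only [Prod.smul_snd, Pi.smul_apply, hx, h1, partialDeriv, h0, fderiv_const_smul dφ,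
        _root_.smul_apply]

/-- The Sobolev space `H¹₀(Ω)`, as the set of pairs `(u, ∇u)`: the closure of
`{(φ, ∇φ) : φ ∈ C_c^∞(Ω)}` in `L²(Ω) × L²(Ω)³`. -/
def sobolevH10 (Ω : Opens E3) : Submodule ℂ (L2 Ω × (Fin 3 → L2 Ω)) :=
  (testPairs Ω).topologicalClosure

/-- The graph of `-Δ_D`, the operator of the Dirichlet form: `(u, f)` belongs to it when
`u ∈ H¹₀(Ω)`, `f ∈ L²(Ω)` and `∫ ∇u · ∇w̄ = ∫ f w̄` for all `w ∈ H¹₀(Ω)`. -/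
def negLaplacianGraph (Ω : Opens E3) : Submodule ℂ (L2 Ω × L2 Ω) where
  carrier := {p | ∃ G : Fin 3 → L2 Ω, (p.1, G) ∈ sobolevH10 Ω ∧
    ∀ w ∈ sobolevH10 Ω, ∑ i, inner ℂ (w.2 i) (G i) = inner ℂ w.1 p.2}
  zero_mem' := ⟨0, (sobolevH10 Ω).zero_mem, fun w _ => by simp⟩
  add_mem' := by
    rintro p r ⟨G, hG, hG'⟩ ⟨K, hK, hK'⟩
    refine ⟨G + K, (sobolevH10 Ω).add_mem hG hK, fun w hw => ?_⟩
    simp [inner_add_right, Finset.sum_add_distrib, hG' w hw, hK' w hw]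
  smul_mem' := by
    rintro c p ⟨G, hG, hG'⟩
    refine ⟨c • G, (sobolevH10 Ω).smul_mem c hG, fun w hw => ?_⟩
    simp [inner_smul_right, ← Finset.mul_sum, hG' w hw]

/-- The eigenspace of `√(-Δ_D)` at the frequency `ν ≥ 0`, i.e. `{u : -Δ_D u = ν² u}`. -/
def eigenspace (Ω : Opens E3) (ν : ℝ≥0) : Submodule ℂ (L2 Ω) :=
  (negLaplacianGraph Ω).comap
    (LinearMap.prod LinearMap.id ((((ν : ℝ) : ℂ) ^ 2) • LinearMap.id))

/-- The spectral subspace of `√(-Δ_D)` for the set of frequencies `S`: the closed span of the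
eigenspaces at frequencies in `S`. For bounded `Ω` the operator `-Δ_D` is nonnegative with compact
resolvent, so that its spectrum consists of eigenvalues only. -/
abbrev spectralSubspace (Ω : Opens E3) (S : Set ℝ≥0) : Submodule ℂ (L2 Ω) :=
  (⨆ ν ∈ S, eigenspace Ω ν).topologicalClosure

/-- The spectral projection `1_{√(-Δ_D) ∈ S}`. -/
def spectralProj (Ω : Opens E3) (S : Set ℝ≥0) : L2 Ω →L[ℂ] L2 Ω :=
  (spectralSubspace Ω S).starProjection

/-- The unit-width spectral projector `Π_Λ = 1_{√(-Δ_D) ∈ [Λ, Λ + 1)}`. -/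
def unitProj (Ω : Opens E3) (Λ : ℝ) : L2 Ω →L[ℂ] L2 Ω :=
  spectralProj Ω {ν | Λ ≤ (ν : ℝ) ∧ (ν : ℝ) < Λ + 1}

/-- `e^{it√(-Δ_D)} u = ∑_ν e^{itν} P_ν u`, where `P_ν` is the projection on the eigenspace of
`√(-Δ_D)` at `ν`. -/
def halfWave (Ω : Opens E3) (t : ℝ) (u : L2 Ω) : L2 Ω :=
  ∑' ν : ℝ≥0, Complex.exp (Complex.I * ((t * ν : ℝ) : ℂ)) • spectralProj Ω {ν} u

/-- `u` belongs to `H^s_D(Ω)`, the domain of `(-Δ_D)^{s/2}`: `∑_ν ν^{2s} ‖P_ν u‖² < ∞`. -/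
def MemHD (Ω : Opens E3) (s : ℝ) (u : L2 Ω) : Prop :=
  Summable fun ν : ℝ≥0 => ((ν : ℝ) ^ s * ‖spectralProj Ω {ν} u‖) ^ 2

/-- The norm of `H^s_D(Ω)`, i.e. the graph norm `(‖u‖² + ‖(-Δ_D)^{s/2} u‖²)^{1/2}`. -/
def normHD (Ω : Opens E3) (s : ℝ) (u : L2 Ω) : ℝ :=
  Real.sqrt (‖u‖ ^ 2 + ∑' ν : ℝ≥0, ((ν : ℝ) ^ s * ‖spectralProj Ω {ν} u‖) ^ 2)

/-- The product measure `dt dx` on `(0, 2π) × Ω`. -/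
def spaceTime (Ω : Opens E3) : Measure (ℝ × E3) :=
  (volume.restrict (Set.Ioo 0 (2 * Real.pi))).prod (vol Ω)

end DirichletWave

end

/-! The wave is treated as a function of time for each fixed `x`. If all frequencies were integers,
`t ↦ v(t, x)` would be a Fourier series on the circle, and the embedding `H^{1/2 - 1/q} ⊂ L^q`
(`exists_lintegral_enorm_rpow_trigPoly_le`) would bound its `L^q` norm in time by a weighted `ℓ²`
sum of its coefficients. Taking the `L^q` norm in `x` and applying Minkowski in `L^{q/2}`, which
needs `q ≥ 2`, moves the norm onto each coefficient (`exists_eLpNorm_trigPoly_le`). The coefficient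
at `k` is the part of the data with frequencies in `[k, k + 1)`, so the projector hypothesis costs
`(1 + k)^δ`, and orthogonality of the eigenspaces sums the squares to the `H_D` norm with exponent
`δ + 1/2 - 1/q` (`exists_eLpNorm_sum_floor_le`).

Genuine frequencies `ν` are replaced by `⌊ν⌋` through the Taylor series of `e^{it(ν - ⌊ν⌋)}`: both
`t` and `ν - ⌊ν⌋` are bounded, so the price is the factor `e^{2π}`
(`eLpNorm_sum_exp_le_of_rounded`).

The bound for finitely many frequencies makes the full series Cauchy in `L^q` of space-time, and
almost everywhere convergent subsequences identify its sum with the half-wave evolution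
(`ae_eq_halfWave_of_hasSum`). -/

/-! ### Trigonometric polynomials in time: Parseval and Chebyshev -/

/-- The trigonometric polynomial `t ↦ ∑_{k ∈ s} e^{itk} c_k`. -/
noncomputable def trigPoly (s : Finset ℕ) (c : ℕ → ℂ) (t : ℝ) : ℂ :=
  ∑ k ∈ s, Complex.exp (Complex.I * ((t * (k : ℝ) : ℝ) : ℂ)) * c k

lemma continuous_trigPoly (s : Finset ℕ) (c : ℕ → ℂ) : Continuous (trigPoly s c) := by
  unfold trigPoly
  fun_prop

lemma norm_trigPoly_le (s : Finset ℕ) (c : ℕ → ℂ) (t : ℝ) :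
    ‖trigPoly s c t‖ ≤ ∑ k ∈ s, ‖c k‖ := by
  refine (norm_sum_le _ _).trans_eq (Finset.sum_congr rfl fun k _ => ?_)
  rw [norm_mul, Complex.norm_exp_I_mul_ofReal, one_mul]

lemma trigPoly_filter_add (s : Finset ℕ) (c : ℕ → ℂ) (p : ℕ → Prop) [DecidablePred p] (t : ℝ) :
    trigPoly (s.filter p) c t + trigPoly (s.filter fun k => ¬ p k) c t = trigPoly s c t :=
  Finset.sum_filter_add_sum_filter_not _ _ _

lemma intervalIntegral_exp_int (n : ℤ) :
    ∫ t in (0 : ℝ)..(2 * Real.pi), Complex.exp (Complex.I * n * (t : ℂ))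
      = if n = 0 then ((2 * Real.pi : ℝ) : ℂ) else 0 := by
  split_ifs with h
  · subst h; simp
  · have hc : Complex.I * (n : ℂ) ≠ 0 := by simp [h]
    rw [integral_exp_mul_complex hc]
    have : Complex.exp (Complex.I * n * ((2 * Real.pi : ℝ) : ℂ)) = 1 := by
      rw [← Complex.exp_int_mul_two_pi_mul_I n]
      congr 1; push_cast; ring
    rw [this]; simp

/-- Parseval's identity for trigonometric polynomials. -/
lemma intervalIntegral_norm_sq_trigPoly (s : Finset ℕ) (c : ℕ → ℂ) :
    ∫ t in (0 : ℝ)..(2 * Real.pi), ‖trigPoly s c t‖ ^ 2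
      = 2 * Real.pi * ∑ k ∈ s, ‖c k‖ ^ 2 := by
  have key : ∀ t : ℝ, ((‖trigPoly s c t‖ ^ 2 : ℝ) : ℂ)
      = ∑ k ∈ s, ∑ l ∈ s, (c k * (starRingEnd ℂ) (c l)) *
          Complex.exp (Complex.I * ((k : ℤ) - (l : ℤ) : ℤ) * (t : ℂ)) := by
    intro t
    push_cast
    rw [← Complex.mul_conj', trigPoly, map_sum, Finset.sum_mul_sum]
    refine Finset.sum_congr rfl fun k _ => Finset.sum_congr rfl fun l _ => ?_
    rw [map_mul, ← Complex.exp_conj]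
    have : Complex.exp (Complex.I * ((k : ℂ) - (l : ℂ)) * (t : ℂ)) =
      Complex.exp (Complex.I * ((t * (k : ℝ) : ℝ) : ℂ)) *
        Complex.exp ((starRingEnd ℂ) (Complex.I * ((t * (l : ℝ) : ℝ) : ℂ))) := by
      rw [← Complex.exp_add]
      congr 1
      simp only [map_mul, Complex.conj_I, Complex.conj_ofReal]
      push_cast
      ring
    rw [this]; ring
  apply Complex.ofReal_injective
  rw [← intervalIntegral.integral_ofReal]
  simp_rw [key]
  rw [intervalIntegral.integral_finsetSum
    (fun k _ => Continuous.intervalIntegrable (by fun_prop) _ _)]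
  push_cast
  rw [Finset.mul_sum]
  refine Finset.sum_congr rfl fun k hk => ?_
  rw [intervalIntegral.integral_finsetSum
    (fun l _ => Continuous.intervalIntegrable (by fun_prop) _ _)]
  simp_rw [intervalIntegral.integral_const_mul]
  rw [Finset.sum_eq_single_of_mem k hk]
  · have h := intervalIntegral_exp_int ((k : ℤ) - k)
    rw [if_pos (sub_self _)] at h
    push_cast at h
    rw [h, Complex.mul_conj']
    ring
  · intro l _ hl
    have h := intervalIntegral_exp_int ((k : ℤ) - l)
    rw [if_neg (by rw [sub_eq_zero]; exact_mod_cast hl.symm)] at h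
    push_cast at h
    rw [h, mul_zero]

lemma lintegral_enorm_sq_trigPoly (s : Finset ℕ) (c : ℕ → ℂ) :
    ∫⁻ t in Set.Ioo 0 (2 * Real.pi), ‖trigPoly s c t‖ₑ ^ (2 : ℝ)
      = ENNReal.ofReal (2 * Real.pi * ∑ k ∈ s, ‖c k‖ ^ 2) := by
  have hpi : (0 : ℝ) ≤ 2 * Real.pi := by positivity
  rw [← intervalIntegral_norm_sq_trigPoly, intervalIntegral.integral_of_le hpi,
    ofReal_integral_eq_lintegral_ofReal, restrict_Ioo_eq_restrict_Ioc]
  · refine lintegral_congr fun t => ?_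
    rw [← ofReal_norm, ENNReal.ofReal_rpow_of_nonneg (norm_nonneg _) (by norm_num)]
    norm_cast
  · have := (((continuous_trigPoly s c).norm.pow 2).intervalIntegrable
      (μ := volume) 0 (2 * Real.pi))
    rwa [intervalIntegrable_iff_integrableOn_Ioc_of_le hpi] at this
  · exact Filter.Eventually.of_forall fun t => by positivity

/-- Chebyshev's inequality in `L²` for trigonometric polynomials. -/
lemma measure_le_norm_trigPoly_le (s : Finset ℕ) (c : ℕ → ℂ) {a : ℝ} (ha : 0 < a) :
    (volume.restrict (Set.Ioo 0 (2 * Real.pi))) {t | a ≤ ‖trigPoly s c t‖}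
      ≤ ENNReal.ofReal (2 * Real.pi * (∑ k ∈ s, ‖c k‖ ^ 2) / a ^ 2) := by
  have h := meas_ge_le_lintegral_div (μ := volume.restrict (Set.Ioo 0 (2 * Real.pi)))
    (f := fun t => ‖trigPoly s c t‖ₑ ^ (2 : ℝ))
    ((continuous_trigPoly s c).measurable.enorm.pow_const _).aemeasurable
    (ε := ENNReal.ofReal (a ^ 2)) (by simpa using by positivity) ENNReal.ofReal_ne_top
  rw [lintegral_enorm_sq_trigPoly, ← ENNReal.ofReal_div_of_pos (by positivity)] at h
  refine le_trans (measure_mono fun t ht => ?_) h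
  simp only [Set.mem_ofPred_eq] at ht ⊢
  rw [← ofReal_norm, ENNReal.ofReal_rpow_of_nonneg (norm_nonneg _) (by norm_num)]
  refine ENNReal.ofReal_le_ofReal ?_
  have : a ^ 2 ≤ ‖trigPoly s c t‖ ^ 2 := by gcongr
  exact_mod_cast this

/-! ### Sobolev embedding on the circle -/

lemma sum_range_one_add_rpow_le {r : ℝ} (hr : 0 < r) (hr1 : r ≤ 1) (n : ℕ) :
    ∑ k ∈ Finset.range n, (1 + (k : ℝ)) ^ (r - 1) ≤ (n : ℝ) ^ r / r := by
  induction n with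
  | zero => simp [Real.zero_rpow hr.ne']
  | succ n ih =>
    rw [Finset.sum_range_succ]
    have hn : (0 : ℝ) < 1 + n := by positivity
    -- Bernoulli for exponents in `(0, 1]` at `1 + s = n / (1 + n)` gives `r (1 + n)^(r - 1) ≤ (1 +
    -- n)^r - n^r`, which telescopes.
    have hb := rpow_one_add_le_one_add_mul_self (s := -1 / (1 + n))
      (by rw [le_div_iff₀ hn]; nlinarith [(Nat.cast_nonneg n : (0 : ℝ) ≤ n)]) hr.le hr1
    have e : 1 + -1 / (1 + (n : ℝ)) = n / (1 + n) := by field_simp; ring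
    rw [e, Real.div_rpow (Nat.cast_nonneg n) hn.le, div_le_iff₀ (by positivity)] at hb
    have e2 : (1 + r * (-1 / (1 + (n : ℝ)))) * (1 + n) ^ r
        = (1 + (n : ℝ)) ^ r - r * (1 + n) ^ (r - 1) := by
      rw [Real.rpow_sub hn, Real.rpow_one]; field_simp; ring
    rw [e2] at hb
    have e3 : ((n + 1 : ℕ) : ℝ) = 1 + n := by push_cast; ring
    rw [e3, le_div_iff₀ hr]
    rw [le_div_iff₀ hr] at ih
    nlinarith

/-- The square of the `H^{1/2 - 1/q}` norm of a trigonometric polynomial. -/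
noncomputable def trigEnergy (q : ℝ) (s : Finset ℕ) (c : ℕ → ℂ) : ℝ :=
  ∑ k ∈ s, (1 + (k : ℝ)) ^ (1 - 2 / q) * ‖c k‖ ^ 2

lemma trigEnergy_nonneg (q : ℝ) (s : Finset ℕ) (c : ℕ → ℂ) : 0 ≤ trigEnergy q s c :=
  Finset.sum_nonneg fun k _ => by positivity

/-- Bernstein's inequality: the sup norm of a trigonometric polynomial of degree `< n`. -/
lemma sq_sum_norm_le_trigEnergy {q : ℝ} (hq : 2 ≤ q) (s : Finset ℕ) (c : ℕ → ℂ) (n : ℕ)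
    (hs : ∀ k ∈ s, k < n) :
    (∑ k ∈ s, ‖c k‖) ^ 2 ≤ q / 2 * (n : ℝ) ^ (2 / q) * trigEnergy q s c := by
  have hq0 : 0 < q := by linarith
  -- Cauchy–Schwarz with reciprocal weights: one factor gives the energy, the other a power sum with
  -- `r = 2 / q`, whence `1 / r = q / 2`.
  have h1 : (∑ k ∈ s, ‖c k‖) = ∑ k ∈ s, (1 + (k : ℝ)) ^ ((2 / q - 1) / 2) *
      ((1 + (k : ℝ)) ^ ((1 - 2 / q) / 2) * ‖c k‖) := by
    refine Finset.sum_congr rfl fun k _ => ?_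
    rw [← mul_assoc, ← Real.rpow_add (by positivity)]
    rw [show (2 / q - 1) / 2 + (1 - 2 / q) / 2 = 0 by ring, Real.rpow_zero, one_mul]
  have sq : ∀ (x y : ℝ), 0 ≤ x → (x ^ (y / 2)) ^ 2 = x ^ y := by
    intro x y hx
    rw [← Real.rpow_natCast, ← Real.rpow_mul hx]; norm_num
  rw [h1]
  refine (Finset.sum_mul_sq_le_sq_mul_sq _ _ _).trans ?_
  have h2 : ∑ k ∈ s, ((1 + (k : ℝ)) ^ ((1 - 2 / q) / 2) * ‖c k‖) ^ 2 = trigEnergy q s c := by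
    refine Finset.sum_congr rfl fun k _ => ?_
    rw [mul_pow, sq _ _ (by positivity)]
  rw [h2]
  refine mul_le_mul_of_nonneg_right ?_ (trigEnergy_nonneg q s c)
  calc ∑ k ∈ s, ((1 + (k : ℝ)) ^ ((2 / q - 1) / 2)) ^ 2
      = ∑ k ∈ s, (1 + (k : ℝ)) ^ (2 / q - 1) :=
        Finset.sum_congr rfl fun k _ => sq _ _ (by positivity)
    _ ≤ ∑ k ∈ Finset.range n, (1 + (k : ℝ)) ^ (2 / q - 1) :=
        Finset.sum_le_sum_of_subset_of_nonneg (fun k hk => Finset.mem_range.2 (hs k hk))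
          fun k _ _ => by positivity
    _ ≤ (n : ℝ) ^ (2 / q) / (2 / q) :=
        sum_range_one_add_rpow_le (by positivity) (by rw [div_le_one hq0]; exact hq) n
    _ = q / 2 * (n : ℝ) ^ (2 / q) := by field_simp

/-- The height at which the frequency `k` starts to count as high. -/
noncomputable def trigThreshold (q E : ℝ) (k : ℕ) : ℝ :=
  Real.sqrt (2 * q * E) * (1 + (k : ℝ)) ^ (1 / q)

/-- The frequency cutoff depends on the height `a`: frequencies with threshold at most `a`
contribute at most `a / 2` in sup norm, so the others must exceed `a / 2`, and Chebyshev applies to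
them alone. -/
lemma measure_lt_norm_trigPoly_le {q : ℝ} (hq : 2 ≤ q) (s : Finset ℕ) (c : ℕ → ℂ) {a : ℝ}
    (ha : 0 < a) :
    (volume.restrict (Set.Ioo 0 (2 * Real.pi))) {t | a < ‖trigPoly s c t‖}
      ≤ ENNReal.ofReal (8 * Real.pi *
        (∑ k ∈ s with a < trigThreshold q (trigEnergy q s c) k, ‖c k‖ ^ 2) / a ^ 2) := by
  set E := trigEnergy q s c with hE
  have hq0 : 0 < q := by linarith
  have hE0 : 0 ≤ E := trigEnergy_nonneg q s c
  -- For the largest low frequency `m`, Bernstein with degree `< m + 1` bounds the squared sum by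
  -- `(q / 2) (1 + m)^(2 / q) E`, a quarter of the squared threshold. This is why the threshold
  -- carries the constant `2 * q`.
  have hlow : (∑ k ∈ s with ¬ a < trigThreshold q E k, ‖c k‖) ≤ a / 2 := by
    set l := s.filter fun k => ¬ a < trigThreshold q E k with hl
    rcases l.eq_empty_or_nonempty with h | h
    · rw [h]; simp; positivity
    · have hm := l.max'_mem h
      set m := l.max' h
      have h1 := sq_sum_norm_le_trigEnergy hq l c (m + 1)
        (fun k hk => Nat.lt_succ_of_le (l.le_max' k hk))
      have h2 : trigEnergy q l c ≤ E :=
        Finset.sum_le_sum_of_subset_of_nonneg (Finset.filter_subset _ _) fun k _ _ => by positivity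
      have h3 : trigThreshold q E m ≤ a := not_lt.1 (Finset.mem_filter.1 hm).2
      have h4 : (trigThreshold q E m) ^ 2 ≤ a ^ 2 := by
        gcongr
        unfold trigThreshold; positivity
      have h5 : (trigThreshold q E m) ^ 2 = 2 * q * E * (1 + (m : ℝ)) ^ (2 / q) := by
        unfold trigThreshold
        rw [mul_pow, Real.sq_sqrt (by positivity), ← Real.rpow_natCast, ← Real.rpow_mul
          (by positivity)]
        congr 2; push_cast; ring
      have h6 : q / 2 * ((m + 1 : ℕ) : ℝ) ^ (2 / q) * trigEnergy q l c
          ≤ q / 2 * ((m + 1 : ℕ) : ℝ) ^ (2 / q) * E := by gcongr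
      have h7 : ((m + 1 : ℕ) : ℝ) = 1 + m := by push_cast; ring
      rw [h7] at h1 h6
      refine (pow_le_pow_iff_left₀ (by positivity) (by positivity) two_ne_zero).1 ?_
      nlinarith
  have h := measure_le_norm_trigPoly_le (s.filter fun k => a < trigThreshold q E k) c
    (half_pos ha)
  have e : 2 * Real.pi * (∑ k ∈ s with a < trigThreshold q E k, ‖c k‖ ^ 2) / (a / 2) ^ 2
      = 8 * Real.pi * (∑ k ∈ s with a < trigThreshold q E k, ‖c k‖ ^ 2) / a ^ 2 := by
    field_simp; ring
  rw [e] at h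
  refine le_trans (measure_mono fun t ht => ?_) h
  simp only [Set.mem_ofPred_eq] at ht ⊢
  have h1 := trigPoly_filter_add s c (fun k => a < trigThreshold q E k) t
  have h2 := norm_trigPoly_le (s.filter fun k => ¬ a < trigThreshold q E k) c t
  rw [← h1] at ht
  have h3 := norm_add_le (trigPoly (s.filter fun k => a < trigThreshold q E k) c t)
    (trigPoly (s.filter fun k => ¬ a < trigThreshold q E k) c t)
  linarith

lemma lintegral_Ioo_rpow {r b : ℝ} (hr : 0 < r) (hb : 0 ≤ b) :
    ∫⁻ a in Set.Ioo 0 b, ENNReal.ofReal (a ^ (r - 1)) = ENNReal.ofReal (b ^ r / r) := by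
  have h1 : IntervalIntegrable (fun x : ℝ => x ^ (r - 1)) volume 0 b :=
    intervalIntegral.intervalIntegrable_rpow' (by linarith)
  rw [intervalIntegrable_iff_integrableOn_Ioc_of_le hb] at h1
  have h2 := integral_rpow (a := 0) (b := b) (r := r - 1) (Or.inl (by linarith))
  rw [sub_add_cancel, Real.zero_rpow hr.ne', sub_zero] at h2
  rw [← h2, intervalIntegral.integral_of_le hb, ofReal_integral_eq_lintegral_ofReal h1,
    restrict_Ioo_eq_restrict_Ioc]
  refine (ae_restrict_iff' measurableSet_Ioc).2 (Filter.Eventually.of_forall fun x hx => ?_)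
  exact Real.rpow_nonneg hx.1.le _

/-- Layer-cake formula with the height-dependent cutoff, then exchange of the sum over frequencies
with the integral over heights. Strictness of `q > 2` makes `a^(q - 3)` integrable at `0`. -/
lemma lintegral_enorm_rpow_trigPoly_le_of_two_lt {q : ℝ} (hq : 2 < q) (s : Finset ℕ) (c : ℕ → ℂ) :
    ∫⁻ t in Set.Ioo 0 (2 * Real.pi), ‖trigPoly s c t‖ₑ ^ q
      ≤ ENNReal.ofReal (8 * Real.pi * q * (2 * q) ^ (q / 2 - 1) / (q - 2)
          * trigEnergy q s c ^ (q / 2)) := by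
  set E := trigEnergy q s c with hE
  have hq0 : 0 < q := by linarith
  have hq2 : 0 < q - 2 := by linarith
  have hE0 : 0 ≤ E := trigEnergy_nonneg q s c
  have h1 : ∫⁻ t in Set.Ioo 0 (2 * Real.pi), ‖trigPoly s c t‖ₑ ^ q
      = ∫⁻ t in Set.Ioo 0 (2 * Real.pi), ENNReal.ofReal (‖trigPoly s c t‖ ^ q) := by
    refine lintegral_congr fun t => ?_
    rw [← ofReal_norm, ENNReal.ofReal_rpow_of_nonneg (norm_nonneg _) hq0.le]
  rw [h1, lintegral_rpow_eq_lintegral_meas_lt_mul _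
    (Filter.Eventually.of_forall fun t => norm_nonneg _)
    (continuous_trigPoly s c).norm.measurable.aemeasurable hq0]
  have h2 : ∫⁻ a in Set.Ioi (0 : ℝ), (volume.restrict (Set.Ioo 0 (2 * Real.pi)))
        {t | a < ‖trigPoly s c t‖} * ENNReal.ofReal (a ^ (q - 1))
      ≤ ∫⁻ a in Set.Ioi (0 : ℝ), ∑ k ∈ s, ENNReal.ofReal (8 * Real.pi * ‖c k‖ ^ 2) *
          (Set.Ioo 0 (trigThreshold q E k)).indicator
            (fun a => ENNReal.ofReal (a ^ (q - 2 - 1))) a := by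
    refine setLIntegral_mono' measurableSet_Ioi fun a ha => ?_
    have ha : 0 < a := ha
    refine (mul_le_mul_left (measure_lt_norm_trigPoly_le hq.le s c ha) _).trans ?_
    rw [← ENNReal.ofReal_mul (by positivity), ← hE]
    have e : 8 * Real.pi * (∑ k ∈ s with a < trigThreshold q E k, ‖c k‖ ^ 2) / a ^ 2 * a ^ (q - 1)
        = ∑ k ∈ s, if a < trigThreshold q E k then
          8 * Real.pi * ‖c k‖ ^ 2 * a ^ (q - 2 - 1) else 0 := by
      rw [← Finset.sum_filter, ← Finset.sum_mul, ← Finset.mul_sum,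
        show q - 2 - 1 = q - 1 - 2 by ring, Real.rpow_sub ha (q - 1) 2, Real.rpow_two]
      ring
    rw [e, ENNReal.ofReal_sum_of_nonneg (fun k _ => by split_ifs <;> positivity)]
    refine Finset.sum_le_sum fun k _ => ?_
    split_ifs with h
    · rw [Set.indicator_of_mem (Set.mem_Ioo.2 ⟨ha, h⟩), ENNReal.ofReal_mul (by positivity)]
    · simp
  -- Frequency `k` is active only below its threshold, whose power `q - 2` contains `(1 + k)^(1 - 2
  -- / q)`: exactly the energy weight, so the sum over `k` supplies one more factor `E`.
  have h3 : ∫⁻ a in Set.Ioi (0 : ℝ), ∑ k ∈ s, ENNReal.ofReal (8 * Real.pi * ‖c k‖ ^ 2) *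
          (Set.Ioo 0 (trigThreshold q E k)).indicator
            (fun a => ENNReal.ofReal (a ^ (q - 2 - 1))) a
      ≤ ENNReal.ofReal (8 * Real.pi * (2 * q) ^ (q / 2 - 1) / (q - 2) * E ^ (q / 2)) := by
    have hmeas : ∀ k, Measurable ((Set.Ioo 0 (trigThreshold q E k)).indicator
        (fun a : ℝ => ENNReal.ofReal (a ^ (q - 2 - 1)))) := fun k =>
      Measurable.indicator (by fun_prop) measurableSet_Ioo
    rw [lintegral_finsetSum _ (fun k _ => (hmeas k).const_mul _)]
    have h4 : ∀ k ∈ s, ∫⁻ a in Set.Ioi (0 : ℝ), ENNReal.ofReal (8 * Real.pi * ‖c k‖ ^ 2) *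
          (Set.Ioo 0 (trigThreshold q E k)).indicator
            (fun a => ENNReal.ofReal (a ^ (q - 2 - 1))) a
        = ENNReal.ofReal (8 * Real.pi * ‖c k‖ ^ 2 * ((2 * q * E) ^ (q / 2 - 1)
            * (1 + (k : ℝ)) ^ (1 - 2 / q) / (q - 2))) := by
      intro k _
      rw [lintegral_const_mul _ (hmeas k), lintegral_indicator measurableSet_Ioo,
        Measure.restrict_restrict measurableSet_Ioo,
        Set.inter_eq_left.2 Set.Ioo_subset_Ioi_self, lintegral_Ioo_rpow hq2
          (by unfold trigThreshold; positivity), ← ENNReal.ofReal_mul (by positivity)]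
      congr 3
      unfold trigThreshold
      rw [Real.mul_rpow (by positivity) (by positivity), Real.sqrt_eq_rpow,
        ← Real.rpow_mul (by positivity), ← Real.rpow_mul (by positivity)]
      congr 2
      · ring
      · field_simp
    rw [Finset.sum_congr rfl h4, ← ENNReal.ofReal_sum_of_nonneg (fun k _ => by positivity)]
    refine ENNReal.ofReal_le_ofReal (le_of_eq ?_)
    have h5 : E ^ (q / 2) = E ^ (q / 2 - 1) * E := by
      rw [← Real.rpow_add_one' hE0 (by linarith)]; congr 1; ring
    rw [h5, Real.mul_rpow (by positivity) hE0]
    nth_rewrite 3 [hE]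
    rw [trigEnergy, Finset.mul_sum, Finset.mul_sum]
    refine Finset.sum_congr rfl fun k _ => ?_
    ring
  refine (mul_le_mul_right (h2.trans h3) _).trans_eq ?_
  rw [← ENNReal.ofReal_mul hq0.le]
  congr 1; ring

/-- The Sobolev embedding `H^{1/2 - 1/q} ⊂ L^q` on the circle. -/
lemma exists_lintegral_enorm_rpow_trigPoly_le {q : ℝ} (hq : 2 ≤ q) :
    ∃ K : ℝ, 0 ≤ K ∧ ∀ (s : Finset ℕ) (c : ℕ → ℂ),
      ∫⁻ t in Set.Ioo 0 (2 * Real.pi), ‖trigPoly s c t‖ₑ ^ q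
        ≤ ENNReal.ofReal (K * trigEnergy q s c ^ (q / 2)) := by
  rcases hq.eq_or_lt with rfl | h
  · refine ⟨2 * Real.pi, by positivity, fun s c => ?_⟩
    rw [lintegral_enorm_sq_trigPoly]
    simp [trigEnergy]
  · have : 0 < q - 2 := by linarith
    exact ⟨_, by positivity, lintegral_enorm_rpow_trigPoly_le_of_two_lt h⟩

/-! ### From the circle to space-time: square functions and rounding of frequencies -/

section SpaceTime

variable {X : Type*} [MeasurableSpace X] {μ : Measure X}

lemma aestronglyMeasurable_exp_mul {ν : ℝ} {f : X → ℂ} {κ : Measure ℝ} [SFinite μ]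
    (hf : AEStronglyMeasurable f μ) :
    AEStronglyMeasurable (fun p : ℝ × X =>
      Complex.exp (Complex.I * ((p.1 * ν : ℝ) : ℂ)) * f p.2) (κ.prod μ) := by
  refine AEStronglyMeasurable.mul ?_ (hf.comp_snd)
  have : Continuous fun t : ℝ => Complex.exp (Complex.I * ((t * ν : ℝ) : ℂ)) := by fun_prop
  exact (this.measurable.comp measurable_fst).aestronglyMeasurable

/-- Minkowski's inequality in `L^{q/2}`. -/
lemma eLpNorm_trigEnergy_le {q : ℝ} (hq : 2 ≤ q) (s : Finset ℕ) {b : ℕ → X → ℂ}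
    (hb : ∀ k, AEStronglyMeasurable (b k) μ) :
    eLpNorm (fun x => trigEnergy q s fun k => b k x) (ENNReal.ofReal (q / 2)) μ
      ≤ ∑ k ∈ s, ENNReal.ofReal ((1 + (k : ℝ)) ^ (1 - 2 / q)) *
          eLpNorm (b k) (ENNReal.ofReal q) μ ^ (2 : ℝ) := by
  have e : (fun x => trigEnergy q s fun k => b k x)
      = ∑ k ∈ s, fun x => (1 + (k : ℝ)) ^ (1 - 2 / q) * ‖b k x‖ ^ (2 : ℝ) := by
    ext x
    simp [trigEnergy, Finset.sum_apply]
  rw [e]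
  refine (eLpNorm_sum_le (fun k _ => ?_) ?_).trans (Finset.sum_le_sum fun k _ => ?_)
  · exact (((hb k).norm.aemeasurable.pow_const _).const_mul _).aestronglyMeasurable
  · rw [← ENNReal.ofReal_one]; exact ENNReal.ofReal_le_ofReal (by linarith)
  · have h1 := eLpNorm_const_smul_le (c := (1 + (k : ℝ)) ^ (1 - 2 / q))
      (f := fun x => ‖b k x‖ ^ (2 : ℝ)) (p := ENNReal.ofReal (q / 2)) (μ := μ)
    rw [eLpNorm_norm_rpow _ (by norm_num : (0 : ℝ) < 2), ← ENNReal.ofReal_mul (by linarith),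
      div_mul_cancel₀ _ (by norm_num), Real.enorm_of_nonneg (by positivity)] at h1
    exact h1

/-- Square function bound for sums with integer time frequencies. -/
lemma exists_eLpNorm_trigPoly_le [SFinite μ] {q : ℝ} (hq : 2 ≤ q) :
    ∃ K : ℝ, 0 ≤ K ∧ ∀ (s : Finset ℕ) (b : ℕ → X → ℂ), (∀ k, AEStronglyMeasurable (b k) μ) →
      eLpNorm (fun p : ℝ × X => trigPoly s (fun k => b k p.2) p.1) (ENNReal.ofReal q)
          ((volume.restrict (Set.Ioo 0 (2 * Real.pi))).prod μ)
        ≤ ENNReal.ofReal K * (∑ k ∈ s, ENNReal.ofReal ((1 + (k : ℝ)) ^ (1 - 2 / q)) *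
          eLpNorm (b k) (ENNReal.ofReal q) μ ^ (2 : ℝ)) ^ (1 / 2 : ℝ) := by
  obtain ⟨K, hK, hKb⟩ := exists_lintegral_enorm_rpow_trigPoly_le hq
  have hq0 : 0 < q := by linarith
  refine ⟨K ^ (1 / q), by positivity, fun s b hb => ?_⟩
  have hmeas : AEStronglyMeasurable (fun p : ℝ × X => trigPoly s (fun k => b k p.2) p.1)
      ((volume.restrict (Set.Ioo 0 (2 * Real.pi))).prod μ) := by
    unfold trigPoly
    exact Finset.aestronglyMeasurable_fun_sum _ fun k _ => aestronglyMeasurable_exp_mul (hb k)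
  rw [eLpNorm_eq_lintegral_rpow_enorm_toReal (by simpa using hq0) ENNReal.ofReal_ne_top,
    ENNReal.toReal_ofReal hq0.le, lintegral_prod_symm _ (hmeas.enorm.pow_const _)]
  -- After Tonelli the time integral is innermost, so the circle estimate applies with `x` frozen.
  have h1 : ∫⁻ x, (∫⁻ t in Set.Ioo 0 (2 * Real.pi), ‖trigPoly s (fun k => b k x) t‖ₑ ^ q) ∂μ
      ≤ ENNReal.ofReal K *
        eLpNorm (fun x => trigEnergy q s fun k => b k x) (ENNReal.ofReal (q / 2)) μ ^ (q / 2) := by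
    rw [eLpNorm_eq_lintegral_rpow_enorm_toReal (by simpa using hq0) ENNReal.ofReal_ne_top,
      ENNReal.toReal_ofReal (by positivity), ← ENNReal.rpow_mul, one_div_mul_cancel (by positivity),
      ENNReal.rpow_one, ← lintegral_const_mul' _ _ ENNReal.ofReal_ne_top]
    refine lintegral_mono fun x => (hKb s _).trans_eq ?_
    rw [ENNReal.ofReal_mul hK, Real.enorm_of_nonneg (trigEnergy_nonneg _ _ _),
      ENNReal.ofReal_rpow_of_nonneg (trigEnergy_nonneg _ _ _) (by positivity)]
  refine (ENNReal.rpow_le_rpow (h1.trans (mul_le_mul_right (ENNReal.rpow_le_rpow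
    (eLpNorm_trigEnergy_le hq s hb) (by positivity)) _)) (by positivity)).trans_eq ?_
  rw [ENNReal.mul_rpow_of_nonneg _ _ (by positivity), ← ENNReal.rpow_mul,
    ENNReal.ofReal_rpow_of_nonneg hK (by positivity)]
  congr 2
  field_simp

/-- Rounding the time frequencies costs at most a constant factor. -/
lemma eLpNorm_sum_exp_le_of_rounded [SFinite μ] {ι : Type*} (F : Finset ι) (ν : ι → ℝ) (n : ι → ℕ)
    {a : ι → X → ℂ} (ha : ∀ i, AEStronglyMeasurable (a i) μ) {q : ℝ≥0∞} (hq : 1 ≤ q) {M : ℝ≥0∞}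
    (hM : ∀ m : ℕ, eLpNorm (fun p : ℝ × X => ∑ i ∈ F,
      Complex.exp (Complex.I * ((p.1 * n i : ℝ) : ℂ)) * (((ν i - n i : ℝ) : ℂ) ^ m * a i p.2)) q
        ((volume.restrict (Set.Ioo 0 (2 * Real.pi))).prod μ) ≤ M) :
    eLpNorm (fun p : ℝ × X => ∑ i ∈ F, Complex.exp (Complex.I * ((p.1 * ν i : ℝ) : ℂ)) * a i p.2) q
        ((volume.restrict (Set.Ioo 0 (2 * Real.pi))).prod μ)
      ≤ ENNReal.ofReal (Real.exp (2 * Real.pi)) * M := by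
  set κ : Measure (ℝ × X) := (volume.restrict (Set.Ioo 0 (2 * Real.pi))).prod μ with hκ
  set T : ℕ → ℝ × X → ℂ := fun m p => ∑ i ∈ F,
    Complex.exp (Complex.I * ((p.1 * n i : ℝ) : ℂ)) * (((ν i - n i : ℝ) : ℂ) ^ m * a i p.2) with hT
  set A : ℕ → ℝ × X → ℂ := fun m p => (Complex.I * (p.1 : ℂ)) ^ m / (m.factorial : ℂ) * T m p
    with hA
  have hTm : ∀ m, AEStronglyMeasurable (T m) κ := fun m =>
    Finset.aestronglyMeasurable_fun_sum _ fun i _ =>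
      aestronglyMeasurable_exp_mul ((ha i).const_mul _)
  have hAm : ∀ m, AEStronglyMeasurable (A m) κ := by
    intro m
    refine AEStronglyMeasurable.mul ?_ (hTm m)
    have : Continuous fun t : ℝ => (Complex.I * (t : ℂ)) ^ m / (m.factorial : ℂ) := by fun_prop
    exact (this.measurable.comp measurable_fst).aestronglyMeasurable
  have hpi : (0 : ℝ) ≤ 2 * Real.pi := by positivity
  have hfst : ∀ᵐ p ∂κ, p.1 ∈ Set.Ioo 0 (2 * Real.pi) :=
    Measure.quasiMeasurePreserving_fst.ae (ae_restrict_mem measurableSet_Ioo)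
  have hAle : ∀ m, eLpNorm (A m) q κ
      ≤ ENNReal.ofReal ((2 * Real.pi) ^ m / m.factorial) * M := by
    intro m
    refine (eLpNorm_le_mul_eLpNorm_of_ae_le_mul (g := T m) ?_ q).trans (mul_le_mul_right (hM m) _)
    filter_upwards [hfst] with p hp
    rw [hA]
    simp only [norm_mul, norm_div, norm_pow, Complex.norm_I, one_mul, Complex.norm_real,
      Complex.norm_natCast, Real.norm_eq_abs]
    have : |p.1| ≤ 2 * Real.pi := by rw [abs_of_pos hp.1]; exact hp.2.le
    gcongr
  have hS : ∀ N, eLpNorm (∑ m ∈ Finset.range N, A m) q κ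
      ≤ ENNReal.ofReal (Real.exp (2 * Real.pi)) * M := by
    intro N
    refine (eLpNorm_sum_le (fun m _ => hAm m) hq).trans
      ((Finset.sum_le_sum fun m _ => hAle m).trans ?_)
    rw [← Finset.sum_mul, ← ENNReal.ofReal_sum_of_nonneg (fun m _ => by positivity)]
    exact mul_le_mul_left (ENNReal.ofReal_le_ofReal (Real.sum_le_exp_of_nonneg hpi N)) _
  -- Fatou: the Taylor partial sums converge pointwise to the unrounded sum and obey a bound uniform
  -- in `N`.
  refine (Lp.eLpNorm_lim_le_liminf_eLpNorm
    (f := fun N => ∑ m ∈ Finset.range N, A m)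
    (fun N => Finset.aestronglyMeasurable_sum _ fun m _ => hAm m) _ ?_).trans ?_
  · refine Filter.Eventually.of_forall fun p => ?_
    have h1 : ∀ N, (∑ m ∈ Finset.range N, A m) p = ∑ i ∈ F,
        Complex.exp (Complex.I * ((p.1 * n i : ℝ) : ℂ)) *
          (∑ m ∈ Finset.range N, (Complex.I * (p.1 : ℂ) * ((ν i - n i : ℝ) : ℂ)) ^ m
            / (m.factorial : ℂ)) * a i p.2 := by
      intro N
      rw [Finset.sum_apply]
      simp only [hA, hT, Finset.mul_sum, Finset.sum_mul]
      rw [Finset.sum_comm]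
      refine Finset.sum_congr rfl fun i _ => Finset.sum_congr rfl fun m _ => ?_
      rw [mul_pow _ ((ν i - n i : ℝ) : ℂ)]; ring
    simp_rw [h1]
    refine tendsto_finsetSum _ fun i _ => ?_
    have h2 : Complex.exp (Complex.I * ((p.1 * ν i : ℝ) : ℂ))
        = Complex.exp (Complex.I * ((p.1 * n i : ℝ) : ℂ)) *
          Complex.exp (Complex.I * (p.1 : ℂ) * ((ν i - n i : ℝ) : ℂ)) := by
      rw [← Complex.exp_add]; congr 1; push_cast; ring
    rw [h2]
    refine Filter.Tendsto.mul_const _ (Filter.Tendsto.const_mul _ ?_)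
    rw [Complex.exp_eq_exp_ℂ]
    exact (NormedSpace.expSeries_div_hasSum_exp _).tendsto_sum_nat
  · exact (Filter.liminf_le_liminf (Filter.Eventually.of_forall hS)).trans (by simp)

end SpaceTime

/-! ### Orthogonality of the eigenspaces and Bessel's inequality -/

namespace DirichletWave

/-- Eigenfunctions of `√(-Δ_D)` at different frequencies are orthogonal. -/
lemma inner_eq_zero_of_mem_eigenspace {Ω : Opens E3} {ν μ : ℝ≥0} (h : ν ≠ μ) {u w : L2 Ω}
    (hu : u ∈ eigenspace Ω ν) (hw : w ∈ eigenspace Ω μ) : inner ℂ u w = 0 := by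
  obtain ⟨G, hG, hG'⟩ := hu
  obtain ⟨K, hK, hK'⟩ := hw
  have h1 := hG' _ hK
  have h2 := hK' _ hG
  simp only [LinearMap.prod_apply, Function.prod_apply, LinearMap.id_apply, LinearMap.smul_apply,
    inner_smul_right] at h1 h2
  -- Each eigenfunction is tested against the other; Hermitian symmetry of the Dirichlet form
  -- equates the two results.
  have h3 : ((ν : ℝ) : ℂ) ^ 2 * inner ℂ u w = ((μ : ℝ) : ℂ) ^ 2 * inner ℂ u w := by
    rw [← h2, ← inner_conj_symm u w]
    have h4 := congrArg (starRingEnd ℂ) h1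
    simp only [map_sum, map_mul, map_pow, Complex.conj_ofReal, inner_conj_symm] at h4
    rw [inner_conj_symm, ← h4]
  have h5 : (((ν : ℝ) : ℂ) ^ 2 - ((μ : ℝ) : ℂ) ^ 2) * inner ℂ u w = 0 := by
    rw [sub_mul, h3, sub_self]
  refine (mul_eq_zero.1 h5).resolve_left fun h6 => h ?_
  rw [sub_eq_zero] at h6
  have h7 : (ν : ℝ) ^ 2 = (μ : ℝ) ^ 2 := by exact_mod_cast h6
  exact NNReal.coe_injective ((pow_left_inj₀ ν.2 μ.2 two_ne_zero).1 h7)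

lemma spectralSubspace_mono (Ω : Opens E3) {S T : Set ℝ≥0} (h : S ⊆ T) :
    spectralSubspace Ω S ≤ spectralSubspace Ω T :=
  Submodule.topologicalClosure_mono (biSup_mono h)

lemma isOrtho_spectralSubspace_singleton (Ω : Opens E3) {ν μ : ℝ≥0} (h : ν ≠ μ) :
    spectralSubspace Ω {ν} ⟂ spectralSubspace Ω {μ} := by
  have h1 : (eigenspace Ω ν) ⟂ eigenspace Ω μ :=
    Submodule.isOrtho_iff_inner_eq.2 fun u hu w hw => inner_eq_zero_of_mem_eigenspace h hu hw
  have h2 : spectralSubspace Ω {ν} ⟂ eigenspace Ω μ := by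
    refine Submodule.topologicalClosure_minimal _ ?_ (Submodule.isClosed_orthogonal _)
    simp only [Set.mem_singleton_iff, iSup_iSup_eq_left]
    exact h1
  refine Submodule.IsOrtho.symm
    (Submodule.topologicalClosure_minimal _ ?_ (Submodule.isClosed_orthogonal _))
  simp only [Set.mem_singleton_iff, iSup_iSup_eq_left]
  exact h2.symm

lemma orthogonalFamily_spectralSubspace (Ω : Opens E3) :
    OrthogonalFamily ℂ (fun ν : ℝ≥0 => spectralSubspace Ω {ν})
      fun ν => (spectralSubspace Ω {ν}).subtypeₗᵢ :=
  OrthogonalFamily.of_pairwise fun _ _ h => isOrtho_spectralSubspace_singleton Ω h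

lemma norm_sq_sum_of_mem_spectralSubspace {Ω : Opens E3} {a : ℝ≥0 → L2 Ω}
    (ha : ∀ ν, a ν ∈ spectralSubspace Ω {ν}) (F : Finset ℝ≥0) :
    ‖∑ ν ∈ F, a ν‖ ^ 2 = ∑ ν ∈ F, ‖a ν‖ ^ 2 :=
  (orthogonalFamily_spectralSubspace Ω).norm_sum (fun ν => ⟨a ν, ha ν⟩) F

lemma spectralProj_mem (Ω : Opens E3) (S : Set ℝ≥0) (u : L2 Ω) :
    spectralProj Ω S u ∈ spectralSubspace Ω S :=
  Submodule.starProjection_apply_mem _ _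

/-- Bessel's inequality for the spectral decomposition. -/
lemma sum_norm_sq_spectralProj_le (Ω : Opens E3) (u : L2 Ω) (F : Finset ℝ≥0) :
    ∑ ν ∈ F, ‖spectralProj Ω {ν} u‖ ^ 2 ≤ ‖u‖ ^ 2 := by
  rw [← norm_sq_sum_of_mem_spectralSubspace (fun ν => spectralProj_mem Ω {ν} u)]
  set S := ∑ ν ∈ F, spectralProj Ω {ν} u with hS
  have h1 : inner ℂ S u = ((‖S‖ ^ 2 : ℝ) : ℂ) := by
    rw [hS, norm_sq_sum_of_mem_spectralSubspace (fun ν => spectralProj_mem Ω {ν} u), sum_inner]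
    push_cast
    refine Finset.sum_congr rfl fun ν _ => ?_
    have h2 := Submodule.starProjection_inner_eq_zero (K := spectralSubspace Ω {ν}) u
      (spectralProj Ω {ν} u) (spectralProj_mem Ω {ν} u)
    rw [inner_sub_left, sub_eq_zero] at h2
    have h3 := congrArg (starRingEnd ℂ) h2
    rw [inner_conj_symm] at h3
    rw [h3, inner_conj_symm]
    exact inner_self_eq_norm_sq_to_K _
  have h4 := norm_inner_le_norm (𝕜 := ℂ) S u
  rw [h1, Complex.norm_real, Real.norm_of_nonneg (by positivity)] at h4
  have h5 : ‖S‖ ≤ ‖u‖ := by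
    rcases (norm_nonneg S).eq_or_lt with h | h
    · rw [← h]; exact norm_nonneg u
    · nlinarith
  gcongr

/-- Compares the rounded inhomogeneous weight with the graph-norm weight. For `σ < 0` the left side
is at most `1`; otherwise `1 + ⌊ν⌋ ≤ 2 max(1, ν)`. -/
lemma one_add_floor_rpow_le (σ : ℝ) (ν : ℝ≥0) :
    (1 + (⌊ν⌋₊ : ℝ)) ^ (2 * σ) ≤ 4 ^ |σ| * (1 + ((ν : ℝ) ^ σ) ^ 2) := by
  have h4 : (1 : ℝ) ≤ 4 ^ |σ| := Real.one_le_rpow (by norm_num) (abs_nonneg _)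
  have hsq : ((ν : ℝ) ^ σ) ^ 2 = (ν : ℝ) ^ (2 * σ) := by
    rw [← Real.rpow_natCast, ← Real.rpow_mul ν.coe_nonneg]; congr 1; push_cast; ring
  rcases lt_or_ge σ 0 with h | h
  · have h1 : (1 + (⌊ν⌋₊ : ℝ)) ^ (2 * σ) ≤ 1 :=
      Real.rpow_le_one_of_one_le_of_nonpos (by simp) (by linarith)
    nlinarith [sq_nonneg ((ν : ℝ) ^ σ)]
  · have hfl : (⌊ν⌋₊ : ℝ) ≤ ν := by exact_mod_cast Nat.floor_le ν.2
    have h44 : (4 : ℝ) ^ |σ| = 2 ^ (2 * σ) := by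
      rw [abs_of_nonneg h, Real.rpow_mul (by norm_num)]; norm_num
    have h1 : (1 + (⌊ν⌋₊ : ℝ)) ^ (2 * σ) ≤ (2 * max 1 (ν : ℝ)) ^ (2 * σ) := by
      refine Real.rpow_le_rpow (by positivity) ?_ (by positivity)
      linarith [le_max_left 1 (ν : ℝ), le_max_right 1 (ν : ℝ)]
    refine h1.trans ?_
    rw [Real.mul_rpow (by norm_num) (by positivity), h44, hsq]
    gcongr
    rcases le_total 1 (ν : ℝ) with h2 | h2
    · rw [max_eq_right h2]; linarith
    · rw [max_eq_left h2, Real.one_rpow]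
      linarith [Real.rpow_nonneg ν.coe_nonneg (2 * σ)]

/-! ### Estimates for finitely many frequencies -/

section Estimate

variable {Ω : Opens E3} {q δ C₀ : ℝ}

/-- The `L^q` bound on the part of `∑ a_ν` with frequencies in `[k, k + 1)`. -/
lemma eLpNorm_sum_floor_eq_le
    (hproj : ∀ Λ : ℝ, 0 ≤ Λ → ∀ u : L2 Ω,
      eLpNorm (unitProj Ω Λ u) (ENNReal.ofReal q) (vol Ω)
        ≤ ENNReal.ofReal (C₀ * (1 + Λ) ^ δ * ‖u‖))
    {a : ℝ≥0 → L2 Ω} (ha : ∀ ν, a ν ∈ spectralSubspace Ω {ν}) (F : Finset ℝ≥0) (k : ℕ) :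
    eLpNorm (∑ ν ∈ F with ⌊ν⌋₊ = k, a ν : L2 Ω) (ENNReal.ofReal q) (vol Ω)
      ≤ ENNReal.ofReal (|C₀| * (1 + (k : ℝ)) ^ δ * ‖∑ ν ∈ F with ⌊ν⌋₊ = k, a ν‖) := by
  set b := ∑ ν ∈ F with ⌊ν⌋₊ = k, a ν with hb
  have h1 : b ∈ spectralSubspace Ω {ν | (k : ℝ) ≤ (ν : ℝ) ∧ (ν : ℝ) < k + 1} := by
    refine Submodule.sum_mem _ fun ν hν => spectralSubspace_mono Ω ?_ (ha ν)
    rw [Set.singleton_subset_iff]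
    have h2 := (Finset.mem_filter.1 hν).2
    rw [Nat.floor_eq_iff (zero_le : 0 ≤ ν)] at h2
    exact ⟨by exact_mod_cast h2.1, by exact_mod_cast h2.2⟩
  -- The block lies in the range of the projector, so the hypothesis bounds the block itself.
  have h3 : unitProj Ω k b = b := Submodule.starProjection_eq_self_iff.2 h1
  have h4 := hproj k (Nat.cast_nonneg k) b
  rw [h3] at h4
  refine h4.trans (ENNReal.ofReal_le_ofReal ?_)
  gcongr
  exact le_abs_self C₀

lemma exists_eLpNorm_sum_floor_le (hq : 2 ≤ q)
    (hproj : ∀ Λ : ℝ, 0 ≤ Λ → ∀ u : L2 Ω,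
      eLpNorm (unitProj Ω Λ u) (ENNReal.ofReal q) (vol Ω)
        ≤ ENNReal.ofReal (C₀ * (1 + Λ) ^ δ * ‖u‖)) :
    ∃ C : ℝ, 0 ≤ C ∧ ∀ a : ℝ≥0 → L2 Ω, (∀ ν, a ν ∈ spectralSubspace Ω {ν}) → ∀ F : Finset ℝ≥0,
      eLpNorm (fun p : ℝ × E3 => ∑ ν ∈ F,
          Complex.exp (Complex.I * ((p.1 * (⌊ν⌋₊ : ℝ) : ℝ) : ℂ)) * a ν p.2)
          (ENNReal.ofReal q) (spaceTime Ω)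
        ≤ ENNReal.ofReal (C * Real.sqrt
          (∑ ν ∈ F, (1 + ((ν : ℝ) ^ (δ + 1 / 2 - 1 / q)) ^ 2) * ‖a ν‖ ^ 2)) := by
  obtain ⟨K, hK, hKb⟩ := exists_eLpNorm_trigPoly_le (μ := vol Ω) hq
  set σ := δ + 1 / 2 - 1 / q with hσ
  refine ⟨K * (|C₀| * Real.sqrt (4 ^ |σ|)), by positivity, fun a ha F => ?_⟩
  set b : ℕ → L2 Ω := fun k => ∑ ν ∈ F with ⌊ν⌋₊ = k, a ν with hb
  -- Summing fixed representatives makes the regrouping by integer part hold at every point; `b k`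
  -- agrees with `c k` only almost everywhere.
  set c : ℕ → E3 → ℂ := fun k x => ∑ ν ∈ F with ⌊ν⌋₊ = k, a ν x with hc
  have hbc : ∀ k, (b k : E3 → ℂ) =ᵐ[vol Ω] c k := fun k => by
    refine (Lp.coeFn_finsetSum _ _).trans (Filter.Eventually.of_forall fun x => ?_)
    simp [hc]
  have hcm : ∀ k, AEStronglyMeasurable (c k) (vol Ω) := fun k =>
    (Lp.aestronglyMeasurable (b k)).congr (hbc k)
  have h1 : (fun p : ℝ × E3 => ∑ ν ∈ F,
      Complex.exp (Complex.I * ((p.1 * (⌊ν⌋₊ : ℝ) : ℝ) : ℂ)) * a ν p.2)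
      = fun p => trigPoly (F.image fun ν => ⌊ν⌋₊) (fun k => c k p.2) p.1 := by
    ext p
    rw [trigPoly, ← Finset.sum_fiberwise_of_maps_to
      (fun ν hν => Finset.mem_image_of_mem (fun ν : ℝ≥0 => ⌊ν⌋₊) hν)]
    refine Finset.sum_congr rfl fun k _ => ?_
    rw [hc, Finset.mul_sum]
    refine Finset.sum_congr rfl fun ν hν => ?_
    rw [(Finset.mem_filter.1 hν).2]
  have hnorm : ∀ k, ‖b k‖ ^ 2 = ∑ ν ∈ F with ⌊ν⌋₊ = k, ‖a ν‖ ^ 2 := fun k =>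
    norm_sq_sum_of_mem_spectralSubspace ha _
  have h2 : ∑ k ∈ F.image (fun ν => ⌊ν⌋₊), ENNReal.ofReal ((1 + (k : ℝ)) ^ (1 - 2 / q)) *
        eLpNorm (c k) (ENNReal.ofReal q) (vol Ω) ^ (2 : ℝ)
      ≤ ENNReal.ofReal (|C₀| ^ 2 * (4 ^ |σ| * ∑ ν ∈ F, (1 + ((ν : ℝ) ^ σ) ^ 2) * ‖a ν‖ ^ 2)) := by
    calc _ ≤ ∑ k ∈ F.image (fun ν => ⌊ν⌋₊), ENNReal.ofReal
            (|C₀| ^ 2 * ∑ ν ∈ F with ⌊ν⌋₊ = k, (1 + (⌊ν⌋₊ : ℝ)) ^ (2 * σ) * ‖a ν‖ ^ 2) := by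
          refine Finset.sum_le_sum fun k _ => ?_
          rw [← eLpNorm_congr_ae (hbc k)]
          refine (mul_le_mul_right (ENNReal.rpow_le_rpow
            (eLpNorm_sum_floor_eq_le hproj ha F k) (by norm_num)) _).trans_eq ?_
          rw [ENNReal.ofReal_rpow_of_nonneg (by positivity) (by norm_num),
            ← ENNReal.ofReal_mul (by positivity)]
          congr 1
          have h3 : ∑ ν ∈ F with ⌊ν⌋₊ = k, (1 + (⌊ν⌋₊ : ℝ)) ^ (2 * σ) * ‖a ν‖ ^ 2
              = (1 + (k : ℝ)) ^ (2 * σ) * ‖b k‖ ^ 2 := by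
            rw [hnorm, Finset.mul_sum]
            exact Finset.sum_congr rfl fun ν hν => by rw [(Finset.mem_filter.1 hν).2]
          -- The exponent `2σ` collects `1 - 2 / q` from the embedding in time and `2δ` from the
          -- projector bound.
          have h4 : (1 + (k : ℝ)) ^ (2 * σ)
              = (1 + (k : ℝ)) ^ (1 - 2 / q) * ((1 + (k : ℝ)) ^ δ) ^ 2 := by
            rw [← Real.rpow_natCast, ← Real.rpow_mul (by positivity),
              ← Real.rpow_add (by positivity)]
            congr 1; rw [hσ]; push_cast; ring
          rw [h3, h4, Real.rpow_two]
          ring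
      _ = ENNReal.ofReal (|C₀| ^ 2 * ∑ ν ∈ F, (1 + (⌊ν⌋₊ : ℝ)) ^ (2 * σ) * ‖a ν‖ ^ 2) := by
          rw [← ENNReal.ofReal_sum_of_nonneg (fun k _ => by positivity), ← Finset.mul_sum,
            Finset.sum_fiberwise_of_maps_to
              (fun ν hν => Finset.mem_image_of_mem (fun ν : ℝ≥0 => ⌊ν⌋₊) hν)]
      _ ≤ _ := by
          refine ENNReal.ofReal_le_ofReal ?_
          gcongr
          rw [Finset.mul_sum]
          refine Finset.sum_le_sum fun ν _ => ?_
          rw [← mul_assoc]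
          gcongr
          exact one_add_floor_rpow_le σ ν
  rw [h1]
  refine (hKb _ c hcm).trans
    ((mul_le_mul_right (ENNReal.rpow_le_rpow h2 (by norm_num)) _).trans_eq ?_)
  rw [ENNReal.ofReal_rpow_of_nonneg (by positivity) (by norm_num), ← ENNReal.ofReal_mul hK,
    ← Real.sqrt_eq_rpow, Real.sqrt_mul (by positivity), Real.sqrt_mul (by positivity),
    Real.sqrt_sq (abs_nonneg _)]
  congr 1; ring

/-- The estimate of the half-wave evolution of data with finitely many frequencies. -/
lemma exists_eLpNorm_sum_exp_le (hq : 2 ≤ q)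
    (hproj : ∀ Λ : ℝ, 0 ≤ Λ → ∀ u : L2 Ω,
      eLpNorm (unitProj Ω Λ u) (ENNReal.ofReal q) (vol Ω)
        ≤ ENNReal.ofReal (C₀ * (1 + Λ) ^ δ * ‖u‖)) :
    ∃ C : ℝ, 0 ≤ C ∧ ∀ a : ℝ≥0 → L2 Ω, (∀ ν, a ν ∈ spectralSubspace Ω {ν}) → ∀ F : Finset ℝ≥0,
      eLpNorm (fun p : ℝ × E3 => ∑ ν ∈ F,
          Complex.exp (Complex.I * ((p.1 * (ν : ℝ) : ℝ) : ℂ)) * a ν p.2)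
          (ENNReal.ofReal q) (spaceTime Ω)
        ≤ ENNReal.ofReal (C * Real.sqrt
          (∑ ν ∈ F, (1 + ((ν : ℝ) ^ (δ + 1 / 2 - 1 / q)) ^ 2) * ‖a ν‖ ^ 2)) := by
  obtain ⟨K, hK, hKb⟩ := exists_eLpNorm_sum_floor_le hq hproj
  refine ⟨Real.exp (2 * Real.pi) * K, by positivity, fun a ha F => ?_⟩
  rw [mul_assoc, ENNReal.ofReal_mul (by positivity)]
  refine eLpNorm_sum_exp_le_of_rounded F (fun ν : ℝ≥0 => (ν : ℝ)) (fun ν => ⌊ν⌋₊)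
    (fun ν => Lp.aestronglyMeasurable (a ν)) ?_ fun m => ?_
  · rw [← ENNReal.ofReal_one]; exact ENNReal.ofReal_le_ofReal (by linarith)
  · set θ : ℝ≥0 → ℂ := fun ν => (((ν : ℝ) - (⌊ν⌋₊ : ℝ) : ℝ) : ℂ) ^ m with hθ
    have hθ1 : ∀ ν, ‖θ ν‖ ≤ 1 := fun ν => by
      rw [hθ]
      simp only [norm_pow, Complex.norm_real, Real.norm_eq_abs]
      have h1 : (⌊ν⌋₊ : ℝ) ≤ ν := by exact_mod_cast Nat.floor_le ν.2
      have h2 : (ν : ℝ) < ⌊ν⌋₊ + 1 := by exact_mod_cast Nat.lt_floor_add_one ν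
      exact pow_le_one₀ (abs_nonneg _) (by rw [abs_le]; constructor <;> linarith)
    have h3 := hKb (fun ν => θ ν • a ν) (fun ν => Submodule.smul_mem _ _ (ha ν)) F
    have hae : (fun p : ℝ × E3 => ∑ ν ∈ F,
          Complex.exp (Complex.I * ((p.1 * (⌊ν⌋₊ : ℝ) : ℝ) : ℂ)) * (θ ν • a ν : L2 Ω) p.2)
        =ᵐ[spaceTime Ω] fun p : ℝ × E3 => ∑ ν ∈ F,
          Complex.exp (Complex.I * ((p.1 * (⌊ν⌋₊ : ℝ) : ℝ) : ℂ)) * (θ ν * a ν p.2) := by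
      have h4 : ∀ᵐ p ∂(spaceTime Ω), ∀ ν ∈ F, (θ ν • a ν : L2 Ω) p.2 = θ ν * a ν p.2 :=
        Measure.quasiMeasurePreserving_snd.ae
          ((Finset.eventually_all F).2 fun ν _ => Lp.coeFn_smul (θ ν) (a ν))
      filter_upwards [h4] with p hp
      exact Finset.sum_congr rfl fun ν hν => by rw [hp ν hν]
    rw [eLpNorm_congr_ae hae] at h3
    refine h3.trans (ENNReal.ofReal_le_ofReal ?_)
    gcongr with ν hν
    rw [norm_smul]
    exact mul_le_of_le_one_left (norm_nonneg _) (hθ1 ν)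

end Estimate

end DirichletWave

/-! ### Passage to infinitely many frequencies -/

namespace DirichletWave

/-- The half-wave evolution of `∑_{ν ∈ F} a_ν` as a function on space-time. -/
noncomputable def finiteWave {Ω : Opens E3} (a : ℝ≥0 → L2 Ω) (F : Finset ℝ≥0) (p : ℝ × E3) : ℂ :=
  ∑ ν ∈ F, Complex.exp (Complex.I * ((p.1 * (ν : ℝ) : ℝ) : ℂ)) * a ν p.2

lemma aestronglyMeasurable_finiteWave {Ω : Opens E3} (a : ℝ≥0 → L2 Ω) (F : Finset ℝ≥0) :
    AEStronglyMeasurable (finiteWave a F) (spaceTime Ω) :=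
  Finset.aestronglyMeasurable_fun_sum _ fun ν _ =>
    aestronglyMeasurable_exp_mul (Lp.aestronglyMeasurable (a ν))

/-- Bessel and orthogonality give unconditional convergence in `L²`, so the `tsum` defining
`halfWave` is a true sum and not the default value `0`. -/
lemma hasSum_halfWave (Ω : Opens E3) (t : ℝ) (u : L2 Ω) :
    HasSum (fun ν : ℝ≥0 => Complex.exp (Complex.I * ((t * ν : ℝ) : ℂ)) • spectralProj Ω {ν} u)
      (halfWave Ω t u) := by
  refine Summable.hasSum ?_
  have h1 : Summable fun ν : ℝ≥0 => ‖spectralProj Ω {ν} u‖ ^ 2 :=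
    summable_of_sum_le (fun ν => by positivity) (sum_norm_sq_spectralProj_le Ω u)
  refine ((orthogonalFamily_spectralSubspace Ω).summable_iff_norm_sq_summable
    (fun ν => ⟨Complex.exp (Complex.I * ((t * ν : ℝ) : ℂ)) • spectralProj Ω {ν} u,
      Submodule.smul_mem _ _ (spectralProj_mem Ω {ν} u)⟩)).2 ?_
  refine h1.congr fun ν => ?_
  rw [Submodule.coe_norm, norm_smul, Complex.norm_exp_I_mul_ofReal, one_mul]

/-- A convergent sum of monochromatic waves in `L^q` of space-time represents the half-wave
evolution. -/
lemma ae_eq_halfWave_of_hasSum {Ω : Opens E3} {q : ℝ≥0∞} [Fact (1 ≤ q)] {u : L2 Ω}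
    (hcount : (Function.support fun ν : ℝ≥0 => spectralProj Ω {ν} u).Countable)
    {f : ℝ≥0 → Lp ℂ q (spaceTime Ω)} {v : Lp ℂ q (spaceTime Ω)} (hf : HasSum f v)
    (hsum : ∀ F : Finset ℝ≥0, (∑ ν ∈ F, f ν : Lp ℂ q (spaceTime Ω)) =ᵐ[spaceTime Ω]
      finiteWave (fun ν => spectralProj Ω {ν} u) F) :
    ∀ᵐ t ∂(volume.restrict (Set.Ioo 0 (2 * Real.pi))),
      (fun x => v (t, x)) =ᵐ[vol Ω] halfWave Ω t u := by
  classical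
  set a : ℝ≥0 → L2 Ω := fun ν => spectralProj Ω {ν} u with ha
  set Z := Function.support a with hZ
  -- The index set `ℝ≥0` is uncountable; a countable support lets a sequence of finite sets exhaust
  -- the sum, as almost everywhere arguments require.
  have : Countable Z := hcount.to_subtype
  obtain ⟨S, hS⟩ := Filter.exists_seq_tendsto (Filter.atTop : Filter (Finset Z))
  set F : ℕ → Finset ℝ≥0 := fun n => (S n).map (Function.Embedding.subtype _) with hF
  have hf0 : Function.support f ⊆ Z := by
    intro ν hν hν0
    have h0 : a ν = 0 := by simpa [hZ] using hν0
    refine hν ?_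
    have h1 := hsum {ν}
    rw [Finset.sum_singleton] at h1
    refine (Lp.eq_zero_iff_ae_eq_zero).2 (h1.trans ?_)
    have h3 : ∀ᵐ x ∂(vol Ω), a ν x = 0 := by
      rw [h0]
      exact Lp.coeFn_zero ℂ 2 (vol Ω)
    have h2 : ∀ᵐ p ∂(spaceTime Ω), a ν p.2 = 0 := Measure.quasiMeasurePreserving_snd.ae h3
    filter_upwards [h2] with p hp
    simp only [finiteWave, Finset.sum_singleton, Pi.zero_apply]
    exact mul_eq_zero_of_right _ hp
  have hv : Filter.Tendsto (fun n => ∑ ν ∈ F n, f ν) Filter.atTop (nhds v) := by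
    have h1 := ((hasSum_subtype_iff_of_support_subset hf0).2 hf).comp hS
    refine h1.congr fun n => ?_
    simp [hF, Finset.sum_map]
  have hw : ∀ t : ℝ, Filter.Tendsto
      (fun n => ∑ ν ∈ F n, Complex.exp (Complex.I * ((t * ν : ℝ) : ℂ)) • a ν) Filter.atTop
      (nhds (halfWave Ω t u)) := by
    intro t
    have h0 : Function.support
        (fun ν : ℝ≥0 => Complex.exp (Complex.I * ((t * ν : ℝ) : ℂ)) • a ν) ⊆ Z :=
      fun ν hν h => hν (by simp only [h, smul_zero])
    have h1 := ((hasSum_subtype_iff_of_support_subset h0).2 (hasSum_halfWave Ω t u)).comp hS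
    refine h1.congr fun n => ?_
    simp [hF, Finset.sum_map]
  obtain ⟨ns, hns, hae⟩ := (tendstoInMeasure_of_tendsto_Lp hv).exists_seq_tendsto_ae
  have hae2 : ∀ᵐ p ∂(spaceTime Ω),
      Filter.Tendsto (fun i => finiteWave a (F (ns i)) p) Filter.atTop (nhds (v p)) := by
    filter_upwards [hae, ae_all_iff.2 fun n => hsum (F n)] with p hp hp2
    exact hp.congr fun i => hp2 (ns i)
  filter_upwards [Measure.ae_ae_of_ae_prod hae2] with t ht
  -- For this fixed `t`, a further subsequence turns `L²` convergence into almost everywhere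
  -- convergence in `x`; both limits are then limits of the same sequence.
  obtain ⟨ms, hms, hae3⟩ := (tendstoInMeasure_of_tendsto_Lp
    ((hw t).comp hns.tendsto_atTop)).exists_seq_tendsto_ae
  have hrep : ∀ n, (∑ ν ∈ F n, Complex.exp (Complex.I * ((t * ν : ℝ) : ℂ)) • a ν : L2 Ω)
      =ᵐ[vol Ω] fun x => finiteWave a (F n) (t, x) := by
    intro n
    refine (Lp.coeFn_finsetSum _ _).trans ?_
    have h1 : ∀ᵐ x ∂(vol Ω), ∀ ν ∈ F n,
        (Complex.exp (Complex.I * ((t * ν : ℝ) : ℂ)) • a ν : L2 Ω) x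
          = Complex.exp (Complex.I * ((t * ν : ℝ) : ℂ)) * a ν x :=
      (Finset.eventually_all (F n)).2 fun ν _ => Lp.coeFn_smul _ (a ν)
    filter_upwards [h1] with x hx
    rw [Finset.sum_apply]
    exact Finset.sum_congr rfl hx
  filter_upwards [ht, hae3, ae_all_iff.2 hrep] with x hx hx2 hx3
  refine tendsto_nhds_unique (hx.comp hms.tendsto_atTop) (hx2.congr fun i => ?_)
  exact hx3 _

end DirichletWave

open DirichletWave in
theorem theorem2 (Ω : Opens E3) (hΩ : Bornology.IsBounded (Ω : Set E3))
    (q δ C₀ : ℝ) (hq : 2 ≤ q)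
    (hproj : ∀ Λ : ℝ, 0 ≤ Λ → ∀ u : L2 Ω,
      eLpNorm (unitProj Ω Λ u) (ENNReal.ofReal q) (vol Ω)
        ≤ ENNReal.ofReal (C₀ * (1 + Λ) ^ δ * ‖u‖)) :
    ∃ C : ℝ, ∀ u₀ : L2 Ω, MemHD Ω (δ + 1 / 2 - 1 / q) u₀ →
      ∃ v : ℝ × E3 → ℂ, AEStronglyMeasurable v (spaceTime Ω) ∧
        (∀ᵐ t ∂(volume.restrict (Set.Ioo 0 (2 * Real.pi))),
          (fun x => v (t, x)) =ᵐ[vol Ω] halfWave Ω t u₀) ∧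
        eLpNorm v (ENNReal.ofReal q) (spaceTime Ω)
          ≤ ENNReal.ofReal (C * normHD Ω (δ + 1 / 2 - 1 / q) u₀) := by
  classical
  obtain ⟨C, hC, hCb⟩ := exists_eLpNorm_sum_exp_le hq hproj
  refine ⟨C, fun u hu => ?_⟩
  set σ := δ + 1 / 2 - 1 / q with hσ
  have hq1 : Fact (1 ≤ ENNReal.ofReal q) :=
    ⟨by rw [← ENNReal.ofReal_one]; exact ENNReal.ofReal_le_ofReal (by linarith)⟩
  set a : ℝ≥0 → L2 Ω := fun ν => spectralProj Ω {ν} u with ha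
  set g : ℝ≥0 → ℝ := fun ν => (1 + ((ν : ℝ) ^ σ) ^ 2) * ‖a ν‖ ^ 2 with hg
  have hg0 : ∀ ν, 0 ≤ g ν := fun ν => by positivity
  have hfin : ∀ F : Finset ℝ≥0, eLpNorm (finiteWave a F) (ENNReal.ofReal q) (spaceTime Ω)
      ≤ ENNReal.ofReal (C * Real.sqrt (∑ ν ∈ F, g ν)) :=
    hCb a fun ν => spectralProj_mem Ω {ν} u
  have hmem : ∀ F, MemLp (finiteWave a F) (ENNReal.ofReal q) (spaceTime Ω) := fun F =>
    ⟨aestronglyMeasurable_finiteWave a F, (hfin F).trans_lt ENNReal.ofReal_lt_top⟩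
  set f : ℝ≥0 → Lp ℂ (ENNReal.ofReal q) (spaceTime Ω) := fun ν => (hmem {ν}).toLp with hf
  have hsum : ∀ F : Finset ℝ≥0, (∑ ν ∈ F, f ν : Lp ℂ (ENNReal.ofReal q) (spaceTime Ω))
      =ᵐ[spaceTime Ω] finiteWave a F := by
    intro F
    refine (Lp.coeFn_finsetSum _ _).trans ?_
    have h1 : ∀ᵐ p ∂(spaceTime Ω), ∀ ν ∈ F, f ν p = finiteWave a {ν} p :=
      (Finset.eventually_all F).2 fun ν _ => (hmem {ν}).coeFn_toLp
    filter_upwards [h1] with p hp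
    rw [Finset.sum_apply, Finset.sum_congr rfl hp]
    simp [finiteWave]
  have hnorm : ∀ F : Finset ℝ≥0, ‖∑ ν ∈ F, f ν‖ ≤ C * Real.sqrt (∑ ν ∈ F, g ν) := by
    intro F
    rw [Lp.norm_def, eLpNorm_congr_ae (hsum F)]
    exact ENNReal.toReal_le_of_le_ofReal (by positivity) (hfin F)
  have hs1 : Summable fun ν : ℝ≥0 => ‖a ν‖ ^ 2 :=
    summable_of_sum_le (fun ν => by positivity) (sum_norm_sq_spectralProj_le Ω u)
  have hgeq : g = fun ν : ℝ≥0 => ‖a ν‖ ^ 2 + ((ν : ℝ) ^ σ * ‖a ν‖) ^ 2 := by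
    ext ν; rw [hg]; ring
  have hgs : Summable g := by rw [hgeq]; exact hs1.add hu
  have hgt : ∑' ν, g ν ≤ ‖u‖ ^ 2 + ∑' ν : ℝ≥0, ((ν : ℝ) ^ σ * ‖a ν‖) ^ 2 := by
    rw [hgeq, hs1.tsum_add hu]
    gcongr
    exact hs1.tsum_le_of_sum_le (sum_norm_sq_spectralProj_le Ω u)
  -- Cauchy criterion: blocks of `f` are controlled by the square root of blocks of the summable
  -- `g`. Dividing by `C + 1` covers `C = 0`.
  have hfs : Summable f := by
    rw [summable_iff_vanishing_norm]
    intro ε hε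
    have hη : 0 < (ε / (C + 1)) ^ 2 := by positivity
    obtain ⟨s, hs⟩ := summable_iff_vanishing_norm.1 hgs _ hη
    refine ⟨s, fun t ht => (hnorm t).trans_lt ?_⟩
    have h1 : ∑ ν ∈ t, g ν < (ε / (C + 1)) ^ 2 := (le_abs_self _).trans_lt (hs t ht)
    have h2 : Real.sqrt (∑ ν ∈ t, g ν) < ε / (C + 1) := by
      rw [Real.sqrt_lt' (by positivity)]; exact h1
    have h3 : (C + 1) * Real.sqrt (∑ ν ∈ t, g ν) < ε := by
      rw [lt_div_iff₀ (by positivity)] at h2; linarith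
    nlinarith [Real.sqrt_nonneg (∑ ν ∈ t, g ν)]
  have hv : ‖∑' ν, f ν‖ ≤ C * normHD Ω σ u := by
    refine le_of_tendsto hfs.hasSum.norm (Filter.Eventually.of_forall fun F => (hnorm F).trans ?_)
    refine mul_le_mul_of_nonneg_left (Real.sqrt_le_sqrt ?_) hC
    exact (hgs.sum_le_tsum F fun ν _ => hg0 ν).trans hgt
  have hcount : (Function.support a).Countable := by
    refine hs1.countable_support.mono fun ν hν => ?_
    simpa using hν
  refine ⟨(∑' ν, f ν : Lp ℂ (ENNReal.ofReal q) (spaceTime Ω)), Lp.aestronglyMeasurable _,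
    ae_eq_halfWave_of_hasSum hcount hfs.hasSum hsum, ?_⟩
  rw [← Lp.enorm_def, ← ofReal_norm]
  exact ENNReal.ofReal_le_ofReal hv
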